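/- Let $\mathbb{D}$ be the open unit disc and let $H^2(\mathbb{D})$ be the Hardy space of functions $f(z)=\sum_{k\ge 0}c_kz^k$ on $\mathbb{D}$ with $\|f\|^2=\sum_{k\ge 0}|c_k|^2<\infty$, with the corresponding inner product $\langle f,g\rangle=\sum_{k\ge 0} c_k\overline{d_k}$ for $g(z)=\sum_{k\ge 0} d_kz^k$. For a tuple $\mathbf a=(a_1,\dots,a_n)\in\mathbb{D}^n$, the double-zero Takenaka–Malmquist (D-TM) system generated by $\mathbf a$ is $${}^{\mathbf a}\tilde B_k(z)=\frac{\sqrt{1-|a_k|^2}}{1-\overline{a_k}z}\prod_{l=1}^{k-1}\left(\frac{z-a_l}{1-\overline{a_l}z}\right)^2,\qquad k=1,\dots,n .$$ For $m\ge 1$, a function $f$ is called an $m$-double-Blaschke form if $f=\sum_{k=1}^m c_k\,{}^{\mathbf a}\tilde B_k$ for some $\mathbf a\in\mathbb{D}^m$ and $c_1,\dots,c_m\in\mathbb{C}$ with $c_m\neq 0$. **Theorem ($n$-Best D-AFD).** Let $n$ be given and let $f\in H^2(\mathbb{D})$. If $f$ is not an $m$-double-Blaschke form for any $m<n$, then there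 exists an $n$-tuple $\mathbf a=(a_1,\dots,a_n)\in\mathbb{D}^n$ such that $$\Big\|f-\sum_{j=1}^n\langle f,{}^{\mathbf a}\tilde B_j\rangle\,{}^{\mathbf a}\tilde B_j\Big\|=\inf_{\mathbf b\in\mathbb{D}^n}\Big\|f-\sum_{j=1}^n\langle f,{}^{\mathbf b}\tilde B_j\rangle\,{}^{\mathbf b}\tilde B_j\Big\| .$$ -/

import Mathlib

open scoped Complex.UnitDisc ComplexConjugate

noncomputable section

/-- `f : 𝔻 → ℂ` is the sum on `𝔻` of the power series with coefficients `c`, and `c` is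
square summable. -/
def IsSquareSummableExpansion (f : 𝔻 → ℂ) (c : ℕ → ℂ) : Prop :=
  Summable (fun k => ‖c k‖ ^ 2) ∧ ∀ z : 𝔻, HasSum (fun k => c k * (z : ℂ) ^ k) (f z)

/-- A square summable sequence, as an element of `ℓ²(ℕ, ℂ)`. -/
def toL2 (c : ℕ → ℂ) (hc : Summable (fun k => ‖c k‖ ^ 2)) : lp (fun _ : ℕ => ℂ) 2 :=
  ⟨c, memℓp_gen (by simpa using hc)⟩

theorem summable_sq_of_l2 (c : lp (fun _ : ℕ => ℂ) 2) : Summable (fun k => ‖c k‖ ^ 2) := by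
  simpa using (memℓp_gen_iff (p := 2) (by norm_num)).1 c.2

theorem IsSquareSummableExpansion.add {f g : 𝔻 → ℂ} {c d : ℕ → ℂ}
    (hf : IsSquareSummableExpansion f c) (hg : IsSquareSummableExpansion g d) :
    IsSquareSummableExpansion (f + g) (c + d) := by
  refine ⟨?_, fun z => ?_⟩
  · exact summable_sq_of_l2 (toL2 c hf.1 + toL2 d hg.1)
  · simpa [add_mul] using (hf.2 z).add (hg.2 z)

theorem IsSquareSummableExpansion.smul {f : 𝔻 → ℂ} {c : ℕ → ℂ} (r : ℂ)
    (hf : IsSquareSummableExpansion f c) :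
    IsSquareSummableExpansion (r • f) (r • c) := by
  refine ⟨?_, fun z => ?_⟩
  · exact summable_sq_of_l2 (r • toL2 c hf.1)
  · simpa [mul_assoc] using (hf.2 z).mul_left r

theorem IsSquareSummableExpansion.zero : IsSquareSummableExpansion 0 0 := by
  refine ⟨?_, fun z => ?_⟩
  · simp
  · simp

/-- Power series coefficients are unique. -/
theorem IsSquareSummableExpansion.unique {f : 𝔻 → ℂ} {c d : ℕ → ℂ}
    (hc : IsSquareSummableExpansion f c) (hd : IsSquareSummableExpansion f d) : c = d := by
  have key : ∀ e : ℕ → ℂ, IsSquareSummableExpansion f e →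
      HasFPowerSeriesAt (fun z : ℂ => if h : ‖z‖ < 1 then f (Complex.UnitDisc.mk z h) else 0)
        (FormalMultilinearSeries.ofScalars ℂ e) 0 := by
    intro e he
    rw [hasFPowerSeriesAt_iff]
    filter_upwards [Metric.ball_mem_nhds (0 : ℂ) one_pos] with z hz
    have hz' : ‖z‖ < 1 := by simpa using hz
    simpa [hz', mul_comm, FormalMultilinearSeries.coeff_ofScalars]
      using he.2 (Complex.UnitDisc.mk z hz')
  have h := (key c hc).eq_formalMultilinearSeries (key d hd)
  funext k
  have := congrArg (fun p => FormalMultilinearSeries.coeff p k) h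
  simpa [FormalMultilinearSeries.coeff_ofScalars] using this

/-- The functions `f = ∑ c k z ^ k` on `𝔻` with square summable coefficients. -/
def hardySubmodule : Submodule ℂ (𝔻 → ℂ) where
  carrier := {f | ∃ c : ℕ → ℂ, IsSquareSummableExpansion f c}
  add_mem' := by
    rintro f g ⟨c, hc⟩ ⟨d, hd⟩
    exact ⟨_, hc.add hd⟩
  zero_mem' := ⟨_, .zero⟩
  smul_mem' := by
    rintro r f ⟨c, hc⟩
    exact ⟨_, hc.smul r⟩

/-- The Hardy space `H²(𝔻)`. -/
def HardyTwo : Type := hardySubmodule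

namespace HardyTwo

instance : AddCommGroup HardyTwo := inferInstanceAs (AddCommGroup hardySubmodule)

instance : Module ℂ HardyTwo := inferInstanceAs (Module ℂ hardySubmodule)

instance : CoeFun HardyTwo (fun _ => 𝔻 → ℂ) := ⟨fun f => f.1⟩

/-- The Taylor coefficients at `0` of a function in the Hardy space. -/
def coeff (f : HardyTwo) : ℕ → ℂ := f.2.choose

theorem coeff_spec (f : HardyTwo) : IsSquareSummableExpansion f (coeff f) := f.2.choose_spec

/-- The linear map sending a function in the Hardy space to its Taylor coefficients. -/
def coeffL2 : HardyTwo →ₗ[ℂ] lp (fun _ : ℕ => ℂ) 2 where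
  toFun f := toL2 (coeff f) (coeff_spec f).1
  map_add' f g := Subtype.ext
    ((coeff_spec (f + g)).unique ((coeff_spec f).add (coeff_spec g)))
  map_smul' r f := Subtype.ext
    ((coeff_spec (r • f)).unique ((coeff_spec f).smul r))

theorem coeffL2_injective : Function.Injective coeffL2 := by
  intro f g h
  have h' : coeff f = coeff g := congrArg (fun c : lp (fun _ : ℕ => ℂ) 2 => (c : ℕ → ℂ)) h
  refine Subtype.ext (funext fun z => ?_)
  have hf := (coeff_spec f).2 z
  rw [h'] at hf
  exact hf.unique ((coeff_spec g).2 z)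

/-- The Hardy norm `‖f‖² = ∑ |c k|²`. -/
instance : NormedAddCommGroup HardyTwo :=
  NormedAddCommGroup.induced HardyTwo (lp (fun _ : ℕ => ℂ) 2) coeffL2 coeffL2_injective

/-- The Hardy inner product, conjugate linear in the first variable as everywhere in Mathlib:
`inner ℂ g f` is the number `∑ (coeff f k) * conj (coeff g k)`, in the usual notation `⟨f, g⟩`. -/
instance : InnerProductSpace ℂ HardyTwo := InnerProductSpace.induced coeffL2

theorem norm_sq_eq_tsum (f : HardyTwo) : ‖f‖ ^ 2 = ∑' k, ‖coeff f k‖ ^ 2 := by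
  have h : ‖f‖ = ‖coeffL2 f‖ := rfl
  have h2 := lp.norm_rpow_eq_tsum (p := 2) (by norm_num) (coeffL2 f)
  have h3 : ∀ k, (coeffL2 f : ℕ → ℂ) k = coeff f k := fun _ => rfl
  rw [h]
  simpa [h3] using h2

theorem inner_eq_tsum (g f : HardyTwo) :
    inner ℂ g f = ∑' k, coeff f k * conj (coeff g k) := rfl

end HardyTwo

/-- The normalized Szegő kernel `e_a`, as a function of a complex variable. -/
def szegoFun (a : 𝔻) (z : ℂ) : ℂ :=
  (Real.sqrt (1 - ‖(a : ℂ)‖ ^ 2) : ℂ) / (1 - conj (a : ℂ) * z)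

/-- The Möbius factor `φ_a(z) = (z - a) / (1 - conj a * z)`. -/
def mobiusFun (a : 𝔻) (z : ℂ) : ℂ := (z - a) / (1 - conj (a : ℂ) * z)

/-- `e_{a_k}(z) * ∏_{l < k} φ_{a_l}(z) ^ 2`, as a function of a complex variable. -/
def doubleTMFun {n : ℕ} (a : Fin n → 𝔻) (k : Fin n) (z : ℂ) : ℂ :=
  szegoFun (a k) z * ∏ l ∈ Finset.Iio k, mobiusFun (a l) z ^ 2

theorem mem_hardySubmodule_of_differentiableOn {F : ℂ → ℂ} {R : NNReal} (hR : 1 < R)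
    (hF : DifferentiableOn ℂ F (Metric.closedBall 0 R)) :
    (fun z : 𝔻 => F z) ∈ hardySubmodule := by
  have hp := hF.hasFPowerSeriesOnBall (zero_lt_one.trans hR)
  set p := cauchyPowerSeries F 0 R
  have hs : Summable fun k => ‖p.coeff k‖ := by
    have h1 : ((1 : NNReal) : ENNReal) < p.radius :=
      lt_of_lt_of_le (by exact_mod_cast hR) hp.r_le
    simpa [FormalMultilinearSeries.norm_apply_eq_norm_coef] using p.summable_norm_mul_pow h1
  refine ⟨p.coeff, ?_, fun z => ?_⟩
  · have ht := hs.tendsto_atTop_zero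
    refine Summable.of_norm_bounded_eventually_nat hs ?_
    filter_upwards [ht.eventually (gt_mem_nhds one_pos)] with k hk
    rw [norm_pow, norm_norm, sq]
    exact mul_le_of_le_one_left (norm_nonneg _) hk.le
  · have hz : (z : ℂ) ∈ Metric.eball (0 : ℂ) R := by
      have h1 := z.norm_lt_one
      have h2 : (1 : ℝ) < R := by exact_mod_cast hR
      have : (z : ℂ) ∈ Metric.ball (0 : ℂ) R := by simpa using h1.trans h2
      simpa using this
    have := hp.hasSum hz
    simpa [mul_comm] using this

theorem exists_radius {n : ℕ} (a : Fin n → 𝔻) :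
    ∃ R : NNReal, 1 < R ∧ ∀ k, ∀ z ∈ Metric.closedBall (0 : ℂ) R,
      1 - conj (a k : ℂ) * z ≠ 0 := by
  have h : ∀ᶠ R : NNReal in nhdsWithin 1 (Set.Ioi 1), ∀ k : Fin n, ‖(a k : ℂ)‖ * R < 1 := by
    rw [Filter.eventually_all]
    intro k
    have hc : Continuous fun R : NNReal => ‖(a k : ℂ)‖ * (R : ℝ) := by fun_prop
    refine nhdsWithin_le_nhds (hc.continuousAt.eventually (gt_mem_nhds ?_))
    simpa using (a k).norm_lt_one
  obtain ⟨R, hR, h1⟩ := (h.and self_mem_nhdsWithin).exists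
  refine ⟨R, h1, fun k z hz h0 => ?_⟩
  have hz' : ‖z‖ ≤ R := by simpa using hz
  have : ‖conj (a k : ℂ) * z‖ = 1 := by rw [← sub_eq_zero.1 h0]; simp
  rw [norm_mul, RCLike.norm_conj] at this
  have := mul_le_mul_of_nonneg_left hz' (norm_nonneg (a k : ℂ))
  linarith [hR k]

theorem doubleTMFun_mem {n : ℕ} (a : Fin n → 𝔻) (k : Fin n) :
    (fun z : 𝔻 => doubleTMFun a k z) ∈ hardySubmodule := by
  obtain ⟨R, hR, h⟩ := exists_radius a
  refine mem_hardySubmodule_of_differentiableOn hR ?_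
  have hd : ∀ l, DifferentiableOn ℂ (fun z : ℂ => 1 - conj (a l : ℂ) * z)
      (Metric.closedBall 0 R) := fun l => by fun_prop
  refine DifferentiableOn.mul ((differentiableOn_const _).div (hd k) (h k)) ?_
  refine DifferentiableOn.fun_finsetProd fun l _ => ?_
  exact ((differentiableOn_id.sub_const _).div (hd l) (h l)).pow 2

/-- The double-zero Takenaka–Malmquist (D-TM) system generated by the tuple `a`, in `H²(𝔻)`. -/
def doubleTM {n : ℕ} (a : Fin n → 𝔻) (k : Fin n) : HardyTwo :=
  ⟨fun z => doubleTMFun a k z, doubleTMFun_mem a k⟩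

/-- `f` is an `m`-double Blaschke form: a linear combination of the D-TM system of an `m`-tuple
(so `m ≥ 1`) whose last coefficient is not zero. -/
def IsDoubleBlaschkeForm (m : ℕ) (f : HardyTwo) : Prop :=
  ∃ (a : Fin m → 𝔻) (c : Fin m → ℂ),
    (∃ hm : 0 < m, c ⟨m - 1, Nat.sub_lt hm one_pos⟩ ≠ 0) ∧ f = ∑ k, c k • doubleTM a k

end

/-! By orthonormality (`orthonormal_doubleTM`), minimizing the distance means maximizing the energy,
the sum of the |⟨f, B_k⟩|². Along a minimizing sequence, let the parameters converge to points p_l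
of the closed disc. Each B_k has norm one and converges pointwise, hence weakly
(`tendsto_inner_of_pointwise`).

If |p_k| = 1, the weak limit is 0, because the normalizing factor vanishes. If |p_k| < 1, every
earlier factor with |p_l| = 1 becomes a unimodular constant, so the limit is a unimodular multiple
of a D-TM function built from the interior points alone. The limiting energy is thus that of the
interior parameters in their original order, and appending arbitrary points after them cannot lower
it (`exists_tendsto_sum_norm_inner_sq_le`). -/

namespace HardyTwo

/-! ### Completeness, reproducing kernels and weak convergence. -/

/-- Evaluation at a point of the disc. -/
def eval (z : 𝔻) : HardyTwo →ₗ[ℂ] ℂ where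
  toFun f := f z
  map_add' _ _ := rfl
  map_smul' _ _ := rfl

theorem ext_fun {f g : HardyTwo} (h : ∀ z : 𝔻, eval z f = eval z g) : f = g :=
  Subtype.ext (funext h)

theorem coeff_eq {f : HardyTwo} {c : ℕ → ℂ} (h : IsSquareSummableExpansion f c) : coeff f = c :=
  (coeff_spec f).unique h

theorem summable_mul_pow {c : ℕ → ℂ} (hc : Summable (fun k => ‖c k‖ ^ 2)) (z : 𝔻) :
    Summable (fun k => c k * (z : ℂ) ^ k) := by
  have hz : Summable (fun k : ℕ => ‖(z : ℂ)‖ ^ k) :=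
    summable_geometric_of_lt_one (norm_nonneg _) z.norm_lt_one
  refine Summable.of_norm_bounded_eventually_nat hz ?_
  filter_upwards [hc.tendsto_atTop_zero.eventually (gt_mem_nhds one_pos)] with k hk
  have h1 : ‖c k‖ ≤ 1 := by
    by_contra! h
    nlinarith
  rw [norm_mul, norm_pow]
  exact mul_le_of_le_one_left (by positivity) h1

theorem coeffL2_surjective : Function.Surjective coeffL2 := by
  intro c
  have h : IsSquareSummableExpansion (fun z : 𝔻 => ∑' k, c k * (z : ℂ) ^ k) c :=
    ⟨summable_sq_of_l2 c, fun z => (summable_mul_pow (summable_sq_of_l2 c) z).hasSum⟩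
  refine ⟨⟨_, c, h⟩, Subtype.ext ?_⟩
  exact coeff_eq (f := ⟨_, c, h⟩) h

/-- Needed for the density criterion by orthogonal complements and for the Neumann series in
`exists_div_one_sub`. -/
instance : CompleteSpace HardyTwo :=
  (IsometryEquiv.mk' (Equiv.ofBijective coeffL2 ⟨coeffL2_injective, coeffL2_surjective⟩)
    (Equiv.ofBijective coeffL2 ⟨coeffL2_injective, coeffL2_surjective⟩).symm
    (Equiv.apply_symm_apply _)
    (AddMonoidHomClass.isometry_of_norm coeffL2 fun _ => rfl)).completeSpace

/-- The reproducing kernel of the Hardy space at `w`. -/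
theorem exists_kernel (w : 𝔻) : ∃ K : HardyTwo,
    IsSquareSummableExpansion K (fun k => conj (w : ℂ) ^ k) ∧
      ∀ z : 𝔻, K z = (1 - conj (w : ℂ) * z)⁻¹ := by
  have h : IsSquareSummableExpansion (fun z : 𝔻 => (1 - conj (w : ℂ) * z)⁻¹)
      (fun k => conj (w : ℂ) ^ k) := by
    refine ⟨?_, fun z => ?_⟩
    · have : ‖(w : ℂ)‖ ^ 2 < 1 := by
        have := w.norm_lt_one
        have := norm_nonneg (w : ℂ)
        nlinarith
      simpa [← pow_mul, mul_comm] using summable_geometric_of_lt_one (sq_nonneg ‖(w : ℂ)‖) this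
    · simp_rw [← mul_pow]
      refine hasSum_geometric_of_norm_lt_one ?_
      rw [norm_mul, RCLike.norm_conj]
      exact mul_lt_one_of_nonneg_of_lt_one_left (norm_nonneg _) w.norm_lt_one z.norm_lt_one.le
  exact ⟨⟨_, _, h⟩, h, fun _ => rfl⟩

/-- The reproducing kernel of the Hardy space at `w`. -/
noncomputable def kernel (w : 𝔻) : HardyTwo := (exists_kernel w).choose

theorem kernel_apply (w z : 𝔻) : eval z (kernel w) = (1 - conj (w : ℂ) * z)⁻¹ :=
  (exists_kernel w).choose_spec.2 z

theorem inner_kernel (w : 𝔻) (f : HardyTwo) : inner ℂ (kernel w) f = eval w f := by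
  have hK : coeff (kernel w) = fun k => conj (w : ℂ) ^ k :=
    coeff_eq (exists_kernel w).choose_spec.1
  refine Eq.trans ?_ ((coeff_spec f).2 w).tsum_eq
  rw [inner_eq_tsum, hK]
  simp

/-- A function orthogonal to every kernel vanishes at every point. -/
theorem span_kernel_dense :
    (Submodule.span ℂ (Set.range kernel)).topologicalClosure = ⊤ := by
  rw [Submodule.topologicalClosure_eq_top_iff, Submodule.eq_bot_iff]
  intro f hf
  refine ext_fun fun z => ?_
  rw [← inner_kernel, map_zero]
  have hz : kernel z ∈ Submodule.span ℂ (Set.range kernel) :=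
    Submodule.subset_span (Set.mem_range_self z)
  exact Submodule.inner_right_of_mem_orthogonal hz hf

/-- Bounded pointwise convergence implies weak convergence in the Hardy space. -/
theorem tendsto_inner_of_pointwise {ι : Type*} {l : Filter ι} {x : ι → HardyTwo} {y : HardyTwo}
    {C : ℝ} (hx : ∀ i, ‖x i‖ ≤ C)
    (h : ∀ z : 𝔻, Filter.Tendsto (fun i => eval z (x i)) l (nhds (eval z y))) (f : HardyTwo) :
    Filter.Tendsto (fun i => inner ℂ (x i) f) l (nhds (inner ℂ y f)) := by
  have hspan : ∀ g ∈ Submodule.span ℂ (Set.range kernel),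
      Filter.Tendsto (fun i => inner ℂ (x i) g) l (nhds (inner ℂ y g)) := by
    intro g hg
    induction hg using Submodule.span_induction with
    | mem g hg =>
      obtain ⟨w, rfl⟩ := hg
      simp_rw [← inner_conj_symm _ (kernel w), inner_kernel]
      exact (Complex.continuous_conj.tendsto _).comp (h w)
    | zero => simpa only [inner_zero_right] using tendsto_const_nhds
    | add g g' _ _ hg hg' => simpa only [inner_add_right] using hg.add hg'
    | smul r g _ hg => simpa only [inner_smul_right] using hg.const_mul r
  have hC : 0 ≤ max C ‖y‖ := (norm_nonneg y).trans (le_max_right _ _)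
  rw [Metric.tendsto_nhds]
  intro ε hε
  have hf : f ∈ closure (Submodule.span ℂ (Set.range kernel) : Set HardyTwo) := by
    rw [← Submodule.topologicalClosure_coe, span_kernel_dense]
    trivial
  -- The `+ 1` keeps the denominator positive even when the norm bound is 0.
  obtain ⟨g, hg, hfg⟩ := Metric.mem_closure_iff.1 hf (ε / (3 * (max C ‖y‖ + 1))) (by positivity)
  have hb : ∀ u : HardyTwo, ‖u‖ ≤ max C ‖y‖ →
      ‖(inner ℂ u f : ℂ) - inner ℂ u g‖ ≤ ε / 3 := by
    intro u hu
    rw [← inner_sub_right]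
    refine (norm_inner_le_norm _ _).trans ?_
    rw [dist_eq_norm] at hfg
    calc ‖u‖ * ‖f - g‖ ≤ (max C ‖y‖ + 1) * (ε / (3 * (max C ‖y‖ + 1))) := by
          gcongr
          linarith
      _ = ε / 3 := by field_simp
  filter_upwards [(Metric.tendsto_nhds.1 (hspan g hg)) (ε / 3) (by positivity)] with i hi
  have h1 := hb (x i) ((hx i).trans (le_max_left _ _))
  have h2 := hb y (le_max_right _ _)
  rw [dist_eq_norm] at hi ⊢
  rw [norm_sub_rev] at h2
  have h3 : (inner ℂ (x i) f : ℂ) - inner ℂ y f = (inner ℂ (x i) f - inner ℂ (x i) g) +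
      (inner ℂ (x i) g - inner ℂ y g) + (inner ℂ y g - inner ℂ y f) := by ring
  rw [h3]
  refine (norm_add₃_le).trans_lt ?_
  linarith

/-! ### Multiplication by Möbius factors. -/

/-- The expansion of `z ↦ z * f z`. -/
theorem expansion_shift (f : HardyTwo) :
    IsSquareSummableExpansion (fun z : 𝔻 => (z : ℂ) * f z)
      (fun k => k.casesOn 0 (coeff f)) := by
  refine ⟨?_, fun z => ?_⟩
  · rw [← summable_nat_add_iff 1]
    exact (coeff_spec f).1
  · rw [← hasSum_nat_add_iff' 1]
    simpa [pow_succ, mul_assoc, mul_comm, mul_left_comm] using ((coeff_spec f).2 z).mul_left (z : ℂ)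

/-- Multiplication by the coordinate, as a linear isometry of the Hardy space. -/
noncomputable def shift : HardyTwo →ₗᵢ[ℂ] HardyTwo where
  toFun f := ⟨fun z => (z : ℂ) * f z, _, expansion_shift f⟩
  map_add' f g := ext_fun fun z => mul_add _ _ _
  map_smul' r f := ext_fun fun z => mul_left_comm _ _ _
  norm_map' f := by
    have h : coeff (⟨fun z => (z : ℂ) * f z, _, expansion_shift f⟩ : HardyTwo) =
        (fun k => k.casesOn 0 (coeff f)) := coeff_eq (expansion_shift f)
    refine (sq_eq_sq₀ (norm_nonneg _) (norm_nonneg _)).1 ?_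
    refine (norm_sq_eq_tsum _).trans ?_
    refine (congrArg (fun c : ℕ → ℂ => ∑' k, ‖c k‖ ^ 2) h).trans ?_
    rw [norm_sq_eq_tsum, (expansion_shift f).1.tsum_eq_zero_add]
    simp

theorem shift_apply (f : HardyTwo) (z : 𝔻) : eval z (shift f) = z * eval z f := rfl

theorem one_sub_conj_mul_ne_zero {p : ℂ} (hp : ‖p‖ ≤ 1) (z : 𝔻) : 1 - conj p * (z : ℂ) ≠ 0 := by
  intro h
  have h1 : ‖conj p * (z : ℂ)‖ = 1 := by rw [← sub_eq_zero.1 h]; simp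
  rw [norm_mul, RCLike.norm_conj] at h1
  have := z.norm_lt_one
  nlinarith [norm_nonneg (z : ℂ)]

/-- Neumann series: the shift scaled by conj a has norm at most |a| < 1. -/
theorem exists_div_one_sub (a : 𝔻) (g : HardyTwo) :
    ∃ h : HardyTwo, h - conj (a : ℂ) • shift h = g := by
  have hn : ‖conj (a : ℂ) • (shift.toContinuousLinearMap : HardyTwo →L[ℂ] HardyTwo)‖ < 1 := by
    rw [norm_smul, RCLike.norm_conj]
    exact mul_lt_one_of_nonneg_of_lt_one_left (norm_nonneg _) a.norm_lt_one
      shift.norm_toContinuousLinearMap_le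
  obtain ⟨u, hu⟩ := isUnit_one_sub_of_norm_lt_one hn
  refine ⟨(u⁻¹ : (HardyTwo →L[ℂ] HardyTwo)ˣ).1 g, ?_⟩
  have : (u.1 * (u⁻¹).1) g = g := by rw [u.mul_inv]; rfl
  rw [hu] at this
  exact this

/-- The shift is isometric, and the two cross terms are complex conjugates. This makes Möbius
multiplication isometric without boundary values. -/
theorem norm_shift_sub_smul (a : ℂ) (h : HardyTwo) :
    ‖shift h - a • h‖ = ‖h - conj a • shift h‖ := by
  refine (sq_eq_sq₀ (norm_nonneg _) (norm_nonneg _)).1 ?_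
  rw [norm_sub_sq (𝕜 := ℂ), norm_sub_sq (𝕜 := ℂ), norm_smul, norm_smul, shift.norm_map,
    inner_smul_right, inner_smul_right, RCLike.norm_conj, ← inner_conj_symm h (shift h),
    ← map_mul, RCLike.conj_re]

/-- Multiplication by a Möbius factor is a linear isometry of the Hardy space. -/
theorem exists_mobiusMul (a : 𝔻) : ∃ M : HardyTwo →ₗᵢ[ℂ] HardyTwo,
    ∀ (g : HardyTwo) (z : 𝔻), eval z (M g) = mobiusFun a z * eval z g := by
  have h : ∀ g : HardyTwo, ∃ F : HardyTwo,
      (∀ z : 𝔻, eval z F = mobiusFun a z * eval z g) ∧ ‖F‖ = ‖g‖ := by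
    intro g
    -- With g = (1 - conj a z) h, the product φ_a g is (z - a) h.
    obtain ⟨h, rfl⟩ := exists_div_one_sub a g
    refine ⟨shift h - (a : ℂ) • h, fun z => ?_, norm_shift_sub_smul _ _⟩
    have := one_sub_conj_mul_ne_zero a.norm_lt_one.le z
    simp only [map_sub, map_smul, smul_eq_mul, shift_apply, mobiusFun]
    rw [div_mul_eq_mul_div, eq_div_iff this]
    ring
  choose F hF hn using h
  refine ⟨⟨⟨⟨F, fun f g => ext_fun fun z => ?_⟩, fun r f => ext_fun fun z => ?_⟩, hn⟩, hF⟩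
  · simp only [map_add, hF, mul_add]
  · simp only [map_smul, smul_eq_mul, RingHom.id_apply, hF, mul_left_comm]

/-- Multiplication by a Möbius factor, as a linear isometry of the Hardy space. -/
noncomputable def mobiusMul (a : 𝔻) : HardyTwo →ₗᵢ[ℂ] HardyTwo := (exists_mobiusMul a).choose

theorem mobiusMul_apply (a : 𝔻) (g : HardyTwo) (z : 𝔻) :
    eval z (mobiusMul a g) = mobiusFun a z * eval z g := (exists_mobiusMul a).choose_spec g z

theorem exists_prod_mobius_mul {ι : Type*} (a : ι → 𝔻) (s : Finset ι) :
    ∃ T : HardyTwo →ₗᵢ[ℂ] HardyTwo,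
      ∀ (g : HardyTwo) (z : 𝔻), eval z (T g) = (∏ l ∈ s, mobiusFun (a l) z ^ 2) * eval z g := by
  classical
  induction s using Finset.induction_on with
  | empty => exact ⟨LinearIsometry.id, fun g z => by simp⟩
  | insert i s hi ih =>
    obtain ⟨T, hT⟩ := ih
    refine ⟨(mobiusMul (a i)).comp ((mobiusMul (a i)).comp T), fun g z => ?_⟩
    rw [LinearIsometry.coe_comp, LinearIsometry.coe_comp, Function.comp_apply,
      Function.comp_apply, mobiusMul_apply, mobiusMul_apply,
      hT, Finset.prod_insert hi]
    ring

/-! ### Orthonormality of the D-TM system. -/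

/-- The normalized Szegő kernel `e_a`, as an element of the Hardy space. -/
noncomputable def szego (a : 𝔻) : HardyTwo := (Real.sqrt (1 - ‖(a : ℂ)‖ ^ 2) : ℂ) • kernel a

theorem szego_apply (a z : 𝔻) : eval z (szego a) = szegoFun a z := by
  rw [szego, map_smul, smul_eq_mul, kernel_apply, szegoFun, div_eq_mul_inv]

theorem one_sub_norm_sq_pos (a : 𝔻) : 0 < 1 - ‖(a : ℂ)‖ ^ 2 := by
  have := a.norm_lt_one
  have := norm_nonneg (a : ℂ)
  nlinarith

theorem norm_szego (a : 𝔻) : ‖szego a‖ = 1 := by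
  refine (sq_eq_sq₀ (norm_nonneg _) zero_le_one).1 ?_
  have hK : ((‖kernel a‖ ^ 2 : ℝ) : ℂ) = ((1 - ‖(a : ℂ)‖ ^ 2 : ℝ) : ℂ)⁻¹ := by
    have := inner_self_eq_norm_sq_to_K (𝕜 := ℂ) (kernel a)
    rw [inner_kernel, kernel_apply, ← Complex.normSq_eq_conj_mul_self] at this
    rw [Complex.normSq_eq_norm_sq] at this
    push_cast at this ⊢
    exact this.symm
  rw [← Complex.ofReal_inv, Complex.ofReal_inj] at hK
  have := one_sub_norm_sq_pos a
  rw [szego, norm_smul, mul_pow, hK, Complex.norm_real, Real.norm_eq_abs, sq_abs,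
    Real.sq_sqrt this.le, mul_inv_cancel₀ this.ne', one_pow]

/-- Pairing with `szego a` evaluates at a, up to a scalar, and φ_a vanishes there. -/
theorem inner_szego_mobiusMul (a : 𝔻) (g : HardyTwo) : inner ℂ (szego a) (mobiusMul a g) = 0 := by
  rw [szego, inner_smul_left, inner_kernel, mobiusMul_apply, mobiusFun]
  simp

end HardyTwo

open HardyTwo

theorem doubleTM_apply {n : ℕ} (a : Fin n → 𝔻) (k : Fin n) (z : 𝔻) :
    eval z (doubleTM a k) = szegoFun (a k) z * ∏ l ∈ Finset.Iio k, mobiusFun (a l) z ^ 2 := rfl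

theorem norm_doubleTM {n : ℕ} (a : Fin n → 𝔻) (k : Fin n) : ‖doubleTM a k‖ = 1 := by
  obtain ⟨T, hT⟩ := exists_prod_mobius_mul a (Finset.Iio k)
  have : doubleTM a k = T (szego (a k)) := ext_fun fun z => by
    rw [hT, doubleTM_apply, szego_apply, mul_comm]
  rw [this, T.norm_map, norm_szego]

/-- The isometry T cancels the factors common to both functions; what remains of the later one still
vanishes at a_j. -/
theorem inner_doubleTM_of_lt {n : ℕ} (a : Fin n → 𝔻) {j k : Fin n} (hjk : j < k) :
    inner ℂ (doubleTM a j) (doubleTM a k) = 0 := by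
  obtain ⟨T, hT⟩ := exists_prod_mobius_mul a (Finset.Iio j)
  obtain ⟨T', hT'⟩ := exists_prod_mobius_mul a (Finset.Ioo j k)
  have h1 : doubleTM a j = T (szego (a j)) := ext_fun fun z => by
    rw [hT, doubleTM_apply, szego_apply, mul_comm]
  have hs : Finset.Iio k = insert j (Finset.Iio j ∪ Finset.Ioo j k) := by
    ext i
    simp only [Finset.mem_Iio, Finset.mem_insert, Finset.mem_union, Finset.mem_Ioo]
    omega
  have hd : Disjoint (Finset.Iio j) (Finset.Ioo j k) := by
    rw [Finset.disjoint_left]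
    intro i hi hi'
    simp only [Finset.mem_Iio, Finset.mem_Ioo] at hi hi'
    omega
  have h2 : doubleTM a k =
      T (mobiusMul (a j) (mobiusMul (a j) (T' (szego (a k))))) := ext_fun fun z => by
    rw [hT, mobiusMul_apply, mobiusMul_apply, hT', doubleTM_apply, szego_apply, hs,
      Finset.prod_insert (by simp), Finset.prod_union hd]
    ring
  rw [h1, h2, T.inner_map_map, inner_szego_mobiusMul]

theorem orthonormal_doubleTM {n : ℕ} (a : Fin n → 𝔻) : Orthonormal ℂ (doubleTM a) := by
  refine ⟨norm_doubleTM a, fun j k hjk => ?_⟩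
  rcases lt_or_gt_of_ne hjk with h | h
  · exact inner_doubleTM_of_lt a h
  · exact inner_eq_zero_symm.1 (inner_doubleTM_of_lt a h)

theorem Orthonormal.norm_sub_sum_sq {E ι : Type*} [NormedAddCommGroup E] [InnerProductSpace ℂ E]
    [Fintype ι] {v : ι → E} (hv : Orthonormal ℂ v) (f : E) :
    ‖f - ∑ j, (inner ℂ (v j) f : ℂ) • v j‖ ^ 2 =
      ‖f‖ ^ 2 - ∑ j, ‖(inner ℂ (v j) f : ℂ)‖ ^ 2 := by
  have h1 : (inner ℂ (∑ j, (inner ℂ (v j) f : ℂ) • v j)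
      (f - ∑ j, (inner ℂ (v j) f : ℂ) • v j) : ℂ) = 0 := by
    rw [sum_inner]
    refine Finset.sum_eq_zero fun j _ => ?_
    rw [inner_smul_left, inner_sub_right, hv.inner_right_fintype, sub_self, mul_zero]
  have h2 : ‖∑ j, (inner ℂ (v j) f : ℂ) • v j‖ ^ 2 = ∑ j, ‖(inner ℂ (v j) f : ℂ)‖ ^ 2 := by
    have := hv.inner_sum (fun j => (inner ℂ (v j) f : ℂ)) (fun j => (inner ℂ (v j) f : ℂ))
      Finset.univ
    rw [inner_self_eq_norm_sq_to_K] at this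
    simp_rw [← Complex.normSq_eq_conj_mul_self, Complex.normSq_eq_norm_sq] at this
    exact Complex.ofReal_injective (by push_cast at this ⊢; exact this)
  have h3 := norm_add_sq_eq_norm_sq_add_norm_sq_of_inner_eq_zero _ _ h1
  rw [add_sub_cancel] at h3
  rw [← h2]
  nlinarith

/-! ### Limits of parameters in the closed disc, and attainment. -/

theorem mobius_eq_neg_of_norm_eq_one {p : ℂ} (hp : ‖p‖ = 1) (z : 𝔻) :
    ((z : ℂ) - p) / (1 - conj p * z) = -p := by
  rw [div_eq_iff (one_sub_conj_mul_ne_zero hp.le z)]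
  have h : p * conj p = 1 := by rw [Complex.mul_conj, Complex.normSq_eq_norm_sq, hp]; simp
  linear_combination (-(z : ℂ)) * h

theorem tendsto_eval_doubleTM {ι : Type*} {L : Filter ι} {n : ℕ}
    {a : ι → Fin n → 𝔻} {p : Fin n → ℂ} (hp : ∀ l, ‖p l‖ ≤ 1)
    (ha : ∀ l, Filter.Tendsto (fun i => (a i l : ℂ)) L (nhds (p l))) (k : Fin n) (z : 𝔻) :
    Filter.Tendsto (fun i => eval z (doubleTM (a i) k)) L
      (nhds ((Real.sqrt (1 - ‖p k‖ ^ 2) : ℂ) / (1 - conj (p k) * z) *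
        ∏ l ∈ Finset.Iio k, (((z : ℂ) - p l) / (1 - conj (p l) * z)) ^ 2)) := by
  have hc : ∀ l, Filter.Tendsto (fun i => 1 - conj (a i l : ℂ) * (z : ℂ)) L
      (nhds (1 - conj (p l) * z)) := fun l =>
    (((Complex.continuous_conj.tendsto _).comp (ha l)).mul_const _).const_sub _
  have hs : Filter.Tendsto (fun i => (Real.sqrt (1 - ‖(a i k : ℂ)‖ ^ 2) : ℂ)) L
      (nhds (Real.sqrt (1 - ‖p k‖ ^ 2) : ℂ)) := by
    have h : Continuous fun w : ℂ => (Real.sqrt (1 - ‖w‖ ^ 2) : ℂ) := by fun_prop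
    exact (h.tendsto _).comp (ha k)
  simp_rw [doubleTM_apply]
  refine (hs.div (hc k) (one_sub_conj_mul_ne_zero (hp k) z)).mul ?_
  exact tendsto_finsetProd _ fun l _ =>
    (((ha l).const_sub _).div (hc l) (one_sub_conj_mul_ne_zero (hp l) z)).pow 2

/-- A permutation of `Fin n` listing the indices satisfying `P` first, in increasing order. -/
theorem exists_perm_Iio_map {n : ℕ} (P : Fin n → Prop) [DecidablePred P] :
    ∃ σ : Equiv.Perm (Fin n), ∀ j, P (σ j) →
      (∀ l < j, P (σ l)) ∧ (Finset.Iio j).map σ.toEmbedding = (Finset.Iio (σ j)).filter P := by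
  -- Sorting by this key moves the indices failing `P` behind all others; the shift by n keeps the
  -- key injective.
  set g : Fin n → ℕ := fun l => if P l then l else n + l with hg
  have hinj : Function.Injective g := by
    intro x y hxy
    simp only [hg] at hxy
    split_ifs at hxy <;> omega
  have hm : StrictMono (g ∘ Tuple.sort g) :=
    (Tuple.monotone_sort g).strictMono_of_injective (hinj.comp (Tuple.sort g).injective)
  refine ⟨Tuple.sort g, fun j hj => ?_⟩
  have hlt : ∀ l, l < j ↔ P (Tuple.sort g l) ∧ Tuple.sort g l < Tuple.sort g j := by
    intro l
    rw [← hm.lt_iff_lt]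
    simp only [hg, Function.comp_apply] at hj ⊢
    rw [if_pos hj]
    split_ifs with h
    · simp [h]
    · simp only [h, false_and, iff_false]
      omega
  refine ⟨fun l hl => ((hlt l).1 hl).1, ?_⟩
  ext i
  obtain ⟨l, rfl⟩ := (Tuple.sort g).surjective i
  simp [hlt, and_comm]

theorem exists_tendsto_sum_norm_inner_sq_le {ι : Type*} {L : Filter ι} {n : ℕ}
    {a : ι → Fin n → 𝔻} {p : Fin n → ℂ} (hp : ∀ l, ‖p l‖ ≤ 1)
    (ha : ∀ l, Filter.Tendsto (fun i => (a i l : ℂ)) L (nhds (p l))) (f : HardyTwo) :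
    ∃ (b : Fin n → 𝔻) (V : ℝ),
      Filter.Tendsto (fun i => ∑ k, ‖(inner ℂ (doubleTM (a i) k) f : ℂ)‖ ^ 2) L (nhds V) ∧
        V ≤ ∑ k, ‖(inner ℂ (doubleTM b k) f : ℂ)‖ ^ 2 := by
  classical
  obtain ⟨σ, hσ⟩ := exists_perm_Iio_map fun l => ‖p l‖ < 1
  -- The default 0 is arbitrary: it fills only slots after the interior points, so it enters no D-TM
  -- function attached to an interior point.
  set b : Fin n → 𝔻 := fun j =>
    if h : ‖p (σ j)‖ < 1 then Complex.UnitDisc.mk (p (σ j)) h else 0 with hb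
  have hbv : ∀ j, ‖p (σ j)‖ < 1 → (b j : ℂ) = p (σ j) := by
    intro j hj
    simp [hb, hj]
  have hlim : ∀ j, Filter.Tendsto (fun i => ‖(inner ℂ (doubleTM (a i) (σ j)) f : ℂ)‖ ^ 2) L
      (nhds (if ‖p (σ j)‖ < 1 then ‖(inner ℂ (doubleTM b j) f : ℂ)‖ ^ 2 else 0)) := by
    intro j
    split_ifs with hj
    · obtain ⟨hI, hmap⟩ := hσ j hj
      -- The unimodular constant left by the earlier boundary parameters.
      set c : ℂ := ∏ l ∈ Finset.Iio (σ j) with ¬ ‖p l‖ < 1, (-p l) ^ 2 with hc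
      have hcn : ‖c‖ = 1 := by
        rw [hc, norm_prod]
        refine Finset.prod_eq_one fun l hl => ?_
        have : ‖p l‖ = 1 := le_antisymm (hp l) (not_lt.1 (Finset.mem_filter.1 hl).2)
        simp [this]
      have hw := tendsto_inner_of_pointwise (y := c • doubleTM b j)
        (fun i => (norm_doubleTM (a i) (σ j)).le) (fun z => by
          convert tendsto_eval_doubleTM hp ha (σ j) z using 2
          rw [map_smul, smul_eq_mul, doubleTM_apply, szegoFun, hbv j hj,
            ← Finset.prod_filter_mul_prod_filter_not (Finset.Iio (σ j)) (fun l => ‖p l‖ < 1),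
            ← hmap, Finset.prod_map]
          have h1 : ∏ l ∈ Finset.Iio j, mobiusFun (b l) z ^ 2 = ∏ l ∈ Finset.Iio j,
              (((z : ℂ) - p (σ.toEmbedding l)) / (1 - conj (p (σ.toEmbedding l)) * z)) ^ 2 := by
            refine Finset.prod_congr rfl fun l hl => ?_
            rw [mobiusFun, hbv l (hI l (Finset.mem_Iio.1 hl))]
            rfl
          have h2 : ∏ l ∈ Finset.Iio (σ j) with ¬ ‖p l‖ < 1,
              (((z : ℂ) - p l) / (1 - conj (p l) * z)) ^ 2 = c := by
            refine Finset.prod_congr rfl fun l hl => ?_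
            rw [mobius_eq_neg_of_norm_eq_one
              (le_antisymm (hp l) (not_lt.1 (Finset.mem_filter.1 hl).2))]
          rw [h1, h2]
          ring) f
      have := hw.norm.pow 2
      rwa [inner_smul_left, norm_mul, RCLike.norm_conj, hcn, one_mul] at this
    · have hj' : ‖p (σ j)‖ = 1 := le_antisymm (hp _) (not_lt.1 hj)
      have hw := tendsto_inner_of_pointwise (y := 0)
        (fun i => (norm_doubleTM (a i) (σ j)).le) (fun z => by
          convert tendsto_eval_doubleTM hp ha (σ j) z using 2
          simp [hj']) f
      simpa only [inner_zero_left, norm_zero, ne_eq, OfNat.ofNat_ne_zero, not_false_eq_true,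
        zero_pow] using hw.norm.pow 2
  refine ⟨b, ∑ j, if ‖p (σ j)‖ < 1 then ‖(inner ℂ (doubleTM b j) f : ℂ)‖ ^ 2 else 0, ?_, ?_⟩
  · simp_rw [← Equiv.sum_comp σ fun k => ‖(inner ℂ (doubleTM (a _) k) f : ℂ)‖ ^ 2]
    exact tendsto_finsetSum _ fun j _ => hlim j
  · refine Finset.sum_le_sum fun j _ => ?_
    split_ifs
    · exact le_rfl
    · positivity

/-- The infimum is attained for every `f` in the Hardy space, so the assumption `hf` is not needed:
the parameters of a minimizing sequence that escape to the boundary contribute nothing in the limit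
and can be replaced by arbitrary points of the disc, placed after the other ones. -/
theorem theorem6p1 (n : ℕ) (f : HardyTwo)
    (hf : ∀ m < n, ¬ IsDoubleBlaschkeForm m f) :
    ∃ a : Fin n → Complex.UnitDisc,
      ‖f - ∑ j, (inner ℂ (doubleTM a j) f : ℂ) • doubleTM a j‖ =
        ⨅ b : Fin n → Complex.UnitDisc,
          ‖f - ∑ j, (inner ℂ (doubleTM b j) f : ℂ) • doubleTM b j‖ := by
  set N : (Fin n → 𝔻) → ℝ := fun b =>
    ‖f - ∑ j, (inner ℂ (doubleTM b j) f : ℂ) • doubleTM b j‖ with hN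
  have hbdd : BddBelow (Set.range N) := ⟨0, by rintro _ ⟨b, rfl⟩; exact norm_nonneg _⟩
  have hsq : ∀ b, N b ^ 2 = ‖f‖ ^ 2 - ∑ j, ‖(inner ℂ (doubleTM b j) f : ℂ)‖ ^ 2 := fun b =>
    (orthonormal_doubleTM b).norm_sub_sum_sq f
  obtain ⟨u, -, hu, hmem⟩ := exists_seq_tendsto_sInf (Set.range_nonempty N) hbdd
  choose a ha using hmem
  -- An ultrafilter makes all parameters converge at once, with no successive subsequences.
  have hlim : Filter.Tendsto (fun i => N (a i)) (Filter.hyperfilter ℕ) (nhds (⨅ b, N b)) := by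
    simp_rw [ha]
    exact hu.mono_left Nat.hyperfilter_le_atTop
  have hp : ∀ l : Fin n, ∃ p : ℂ, ‖p‖ ≤ 1 ∧
      Filter.Tendsto (fun i => (a i l : ℂ)) (Filter.hyperfilter ℕ) (nhds p) := by
    intro l
    obtain ⟨p, hp, h⟩ := (isCompact_closedBall (0 : ℂ) 1).ultrafilter_le_nhds
      ((Filter.hyperfilter ℕ).map fun i => (a i l : ℂ))
      (Filter.le_principal_iff.2 (Filter.mem_map.2 (Filter.Eventually.of_forall fun i => by
        simpa using (a i l).norm_lt_one.le)))
    exact ⟨p, by simpa using hp, h⟩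
  choose p hp1 hp2 using hp
  obtain ⟨b, V, hV, hle⟩ := exists_tendsto_sum_norm_inner_sq_le hp1 hp2 f
  refine ⟨b, le_antisymm ?_ (ciInf_le hbdd b)⟩
  have h1 := (hlim.pow 2)
  simp_rw [hsq] at h1
  have h2 := tendsto_nhds_unique h1 (hV.const_sub _)
  refine (sq_le_sq₀ (norm_nonneg _) (Real.iInf_nonneg fun _ => norm_nonneg _)).1 ?_
  change N b ^ 2 ≤ (⨅ b, N b) ^ 2
  rw [h2, hsq]
  linarith
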